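/- **Theorem.** Let $H,U$ be separable real Hilbert spaces. Let $\Omega$ be a Polish space, $\mathcal F$ a $\sigma$-field on $\Omega$ containing all Borel sets, and $\mathbb P$ an atomless probability measure on $(\Omega,\mathcal F)$. Let $\mathcal P_2(H)$ be the set of Borel probability measures on $H$ with finite second moment, $\mathcal L(X)$ the law of $X$, and $L(H,U)$ the space of bounded linear operators with the operator norm; $L^p$-spaces are Bochner spaces. For a bounded linear operator $L:L^2(\Omega,H)\to U$ define the 2-variation norm $$|||L|||_{2,\mathbb P}:=\sup\Big\{\sum_{i=1}^n\|L(\mathbf 1_{A_i}x_i)\|_U : n\in\mathbb N,\ A_i\in\mathcal F \text{ pairwise disjoint},\ x_i\in H,\ \mathbb E\Big\|\sum_{i=1}^n\mathbf 1_{A_i}x_i\Big\|_H^2\le 1\Big\}\in[0,\infty],$$ let $\Lambda_2^{\mathbb P}(H,U)$ be the space of those $L$ with $|||L|||_{2,\mathbb P}<\infty$, normed by $|||\cdot|||_{2,\mathbb P}$, and let $m_L:\mathcal F\to L(H,U)$, $m_L(A)u:=L(\mathbf 1_Au)$, be the vector measure associated with $L$. Let $f:\mathcal P_2(H)\to U$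 be such that its lift $\hat f:L^2(\Omega,H)\to U$, $\hat f(X):=f(\mathcal L(X))$, is Fréchet differentiable with $D\hat f(X)\in\Lambda_2^{\mathbb P}(H,U)$ for all $X$, and such that $D\hat f:L^2(\Omega,H)\to\Lambda_2^{\mathbb P}(H,U)$ is continuous. Then for every $\mu\in\mathcal P_2(H)$ there is a strongly measurable map $\frac{dm_\mu}{d\mu}:H\to L(H,U)$ in $\mathcal L^2(H,\mu;L(H,U))$ such that for every $X\in L^2(\Omega,H)$ with $\mathcal L(X)=\mu$: 1. $\frac{dm_\mu}{d\mu}(X)\in L^2(\Omega,L(H,U))$, and for every $Y\in L^2(\Omega,H)$ one has $\frac{dm_\mu}{d\mu}(X)Y\in L^1(\Omega,U)$, both $Y$ and $\mathbb E[Y|X]$ are integrable with respect to $m_{D\hat f(X)}$, and $$D\hat f(X)Y=\int Y\,dm_{D\hat f(X)}=\int\mathbb E[Y|X]\,dm_{D\hat f(X)}=\mathbb E\Big[\frac{dm_\mu}{d\mu}(X)Y\Big].$$ 2. $\mathbb E\big[\|\frac{dm_\mu}{d\mu}(X)\|^2\big]^{1/2}=|||D\hat f(X)|||_{2,\mathbb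 P}$. 3. $\frac{dm_\mu}{d\mu}$ is the Radon–Nikodym derivative of the image measure $m_\mu:=m_{D\hat f(X)}\circ X^{-1}$ with respect to $\mu$: $m_\mu(A)=\int_A\frac{dm_\mu}{d\mu}\,d\mu$ in $L(H,U)$, so $m_\mu(A)u=\int_A\frac{dm_\mu}{d\mu}(x)u\,\mu(dx)$, for all Borel sets $A\subseteq H$ and all $u\in H$; and it is the only element of $L^2(H,\mu;L(H,U))$ with this property. Finally, the class of $\frac{dm_\mu}{d\mu}$ in $L^2(H,\mu;L(H,U))$ is the unique $G\in L^2(H,\mu;L(H,U))$ with $D\hat f(X)Y=\mathbb E[G(X)Y]$ for all $X\in L^2(\Omega,H)$ with $\mathcal L(X)=\mu$ and all $Y\in L^2(\Omega,H)$; it is the L-derivative $\partial_\mu f(\mu)$. -/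

import Mathlib

open MeasureTheory Filter Topology
open scoped ENNReal

noncomputable section

namespace LionsDeriv

/-- `𝒫₂(H)`: the Borel probability measures on `H` with finite second moment. -/
def P2 (H : Type*) [NormedAddCommGroup H] [MeasurableSpace H] : Type _ :=
  {μ : Measure H // IsProbabilityMeasure μ ∧ ∫⁻ x, ‖x‖ₑ ^ 2 ∂μ < ∞}

/-- `P` is atomless: every measurable set of positive measure has a measurable subset of strictly
smaller positive measure. -/
def Atomless {Ω : Type*} [MeasurableSpace Ω] (P : Measure Ω) : Prop :=
  ∀ A, MeasurableSet A → 0 < P A → ∃ B ⊆ A, MeasurableSet B ∧ 0 < P B ∧ P B < P A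

section

variable {Ω H U : Type*} [MeasurableSpace Ω]
  [NormedAddCommGroup H] [InnerProductSpace ℝ H]
  [NormedAddCommGroup U] [InnerProductSpace ℝ U]

theorem measurable_coeFn_Lp {Ω H : Type*} [MeasurableSpace Ω] [NormedAddCommGroup H]
    [MeasurableSpace H] [BorelSpace H] {P : Measure Ω} (X : Lp H 2 P) :
    Measurable (X : Ω → H) :=
  (Lp.stronglyMeasurable X).measurable

/-- The law `ℒ(X)` of a square integrable random variable, as an element of `𝒫₂(H)`. -/
def law [MeasurableSpace H] [BorelSpace H] (P : Measure Ω) [IsProbabilityMeasure P]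
    (X : Lp H 2 P) : P2 H :=
  ⟨P.map X, Measure.isProbabilityMeasure_map (measurable_coeFn_Lp X).aemeasurable, by
    rw [lintegral_map (by fun_prop) (measurable_coeFn_Lp X)]
    have h := lintegral_rpow_enorm_lt_top_of_eLpNorm_lt_top (p := 2) (by simp) (by simp)
      (Lp.memLp X).2
    simpa using h⟩

/-- The lift `X ↦ f(ℒ(X))` of `f : 𝒫₂(H) → U` to `L²(Ω, H)`. -/
def lift [MeasurableSpace H] [BorelSpace H] (P : Measure Ω) [IsProbabilityMeasure P]
    (f : P2 H → U) : Lp H 2 P → U :=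
  fun X => f (law P X)

/-- The 2-variation norm of a continuous linear operator `L : L²(Ω, H) → U`, with values in
`[0, ∞]`: the supremum of `∑ i, ‖L (1_{A i} x i)‖` over all step functions
`Y = ∑ i, 1_{A i} x i` with `A i` disjoint and `𝔼[‖Y‖²] ≤ 1`. -/
def twoVariation (P : Measure Ω) [IsProbabilityMeasure P] (L : Lp H 2 P →L[ℝ] U) : ℝ≥0∞ :=
  ⨆ (n : ℕ) (A : Fin n → Set Ω) (x : Fin n → H) (hA : ∀ i, MeasurableSet (A i))
    (_ : Pairwise fun i j => Disjoint (A i) (A j))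
    (_ : ∫⁻ ω, ‖∑ i, (A i).indicator (fun _ => x i) ω‖ₑ ^ 2 ∂P ≤ 1),
    ∑ i, ‖L (indicatorConstLp 2 (hA i) (measure_ne_top P (A i)) (x i))‖ₑ

/-- `F : L²(Ω, H) → U` is Λ-continuous Fréchet differentiable: it is Fréchet differentiable,
`DF(X)` has finite 2-variation norm for every `X`, and `X ↦ DF(X)` is continuous with respect to
the 2-variation norm. -/
structure LambdaContDiff (P : Measure Ω) [IsProbabilityMeasure P] (F : Lp H 2 P → U) : Prop where
  differentiable : Differentiable ℝ F
  finite : ∀ X, twoVariation P (fderiv ℝ F X) < ∞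
  continuous : ∀ X, Tendsto (fun Z => twoVariation P (fderiv ℝ F Z - fderiv ℝ F X)) (𝓝 X) (𝓝 0)

/-- For measurable `A`, the operator `u ↦ L (1_A u)`. -/
def indicatorOp (P : Measure Ω) [IsProbabilityMeasure P] (L : Lp H 2 P →L[ℝ] U)
    {A : Set Ω} (hA : MeasurableSet A) : H →L[ℝ] U :=
  LinearMap.mkContinuous
    { toFun := fun u => L (indicatorConstLp 2 hA (measure_ne_top P A) u)
      map_add' := fun u v => by rw [← indicatorConstLp_add, map_add]
      map_smul' := fun c u => by
        rw [RingHom.id_apply, ← map_smul]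
        congr 1
        apply Lp.ext
        filter_upwards [indicatorConstLp_coeFn (p := 2) (hs := hA) (hμs := measure_ne_top P A)
            (c := c • u), Lp.coeFn_smul c (indicatorConstLp 2 hA (measure_ne_top P A) u),
          indicatorConstLp_coeFn (p := 2) (hs := hA) (hμs := measure_ne_top P A) (c := u)]
          with ω h1 h2 h3
        rw [h1, h2, Pi.smul_apply, h3]
        by_cases hω : ω ∈ A <;> simp [hω] }
    (‖L‖ * P.real A ^ (1 / (2 : ℝ≥0∞).toReal)) (fun u => by
      refine (L.le_opNorm _).trans ?_
      rw [mul_assoc]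
      gcongr
      rw [mul_comm]
      exact norm_indicatorConstLp_le)

theorem indicatorOp_apply (P : Measure Ω) [IsProbabilityMeasure P] (L : Lp H 2 P →L[ℝ] U)
    {A : Set Ω} (hA : MeasurableSet A) (u : H) :
    indicatorOp P L hA u = L (indicatorConstLp 2 hA (measure_ne_top P A) u) := rfl

theorem norm_indicatorOp_le (P : Measure Ω) [IsProbabilityMeasure P] (L : Lp H 2 P →L[ℝ] U)
    {A : Set Ω} (hA : MeasurableSet A) :
    ‖indicatorOp P L hA‖ ≤ ‖L‖ * P.real A ^ (1 / (2 : ℝ≥0∞).toReal) :=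
  LinearMap.mkContinuous_norm_le _ (by positivity) _

theorem indicatorOp_union (P : Measure Ω) [IsProbabilityMeasure P] (L : Lp H 2 P →L[ℝ] U)
    {A B : Set Ω} (hA : MeasurableSet A) (hB : MeasurableSet B) (hAB : Disjoint A B) :
    indicatorOp P L (hA.union hB) = indicatorOp P L hA + indicatorOp P L hB := by
  ext u
  simp only [_root_.add_apply, indicatorOp_apply, ← map_add]
  rw [indicatorConstLp_disjoint_union hA hB (measure_ne_top P A) (measure_ne_top P B) hAB]

open Classical in
/-- The vector measure `m_L : 𝓕 → L(H, U)`, `m_L(A) u = L (1_A u)`, associated with an operator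
`L : L²(Ω, H) → U` (on non-measurable sets it is `0` by the convention of `VectorMeasure`). -/
def opMeasure (P : Measure Ω) [IsProbabilityMeasure P] (L : Lp H 2 P →L[ℝ] U) :
    VectorMeasure Ω (H →L[ℝ] U) where
  measureOf' A := if hA : MeasurableSet A then indicatorOp P L hA else 0
  empty' := by
    rw [dif_pos MeasurableSet.empty]
    ext u
    rw [indicatorOp_apply, indicatorConstLp_empty]
    simp
  not_measurable' A hA := dif_neg hA
  m_iUnion' A hA hd := by
    have hfin : ∀ s : Finset ℕ, MeasurableSet (⋃ i ∈ s, A i) := fun s =>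
      Finset.measurableSet_biUnion s fun i _ => hA i
    have hsum : ∀ s : Finset ℕ, ∑ i ∈ s, indicatorOp P L (hA i) = indicatorOp P L (hfin s) := by
      intro s
      induction s using Finset.induction_on with
      | empty =>
        ext u
        have : indicatorOp P L (hfin ∅) u
            = L (indicatorConstLp 2 MeasurableSet.empty (measure_ne_top P ∅) u) := by
          rw [indicatorOp_apply]; congr 2; simp
        rw [this, indicatorConstLp_empty]
        simp
      | insert a s ha ih =>
        have hdis : Disjoint (A a) (⋃ i ∈ s, A i) := by
          simp only [Set.disjoint_iUnion_right]
          intro i hi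
          exact hd (fun h => ha (h ▸ hi))
        rw [Finset.sum_insert ha, ih, ← indicatorOp_union P L (hA a) (hfin s) hdis]
        congr 1
        simp
    simp only [hA, MeasurableSet.iUnion hA, dif_pos]
    rw [HasSum]
    simp only [SummationFilter.unconditional_filter]
    rw [tendsto_iff_norm_sub_tendsto_zero]
    have htail : Tendsto (fun s : Finset ℕ => P.real ((⋃ i, A i) \ ⋃ i ∈ s, A i)) atTop (𝓝 0) := by
      have hS : HasSum (fun i => P.real (A i)) (P.real (⋃ i, A i)) := by
        have h := measure_iUnion (μ := P) hd hA
        have h1 : ∑' i, P (A i) ≠ ∞ := h ▸ measure_ne_top P _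
        have h2 := ENNReal.hasSum_toReal h1
        rw [← ENNReal.tsum_toReal_eq (fun i => measure_ne_top P (A i)), ← h] at h2
        exact h2
      have h3 : Tendsto (fun s : Finset ℕ => P.real (⋃ i, A i) - ∑ i ∈ s, P.real (A i))
          atTop (𝓝 0) := by
        simpa using (tendsto_const_nhds (x := P.real (⋃ i, A i))).sub hS
      refine h3.congr fun s => ?_
      rw [measureReal_sdiff (Set.iUnion₂_subset fun i _ => Set.subset_iUnion A i) (hfin s),
        measureReal_biUnion_finset (fun i _ j _ hij => hd hij) fun i _ => hA i]
    have hlim : Tendsto (fun s : Finset ℕ => ‖L‖ *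
        P.real ((⋃ i, A i) \ ⋃ i ∈ s, A i) ^ (1 / (2 : ℝ≥0∞).toReal)) atTop (𝓝 0) := by
      have h := (htail.rpow_const (p := 1 / (2 : ℝ≥0∞).toReal) (Or.inr (by simp))).const_mul ‖L‖
      simpa using h
    refine squeeze_zero (fun _ => norm_nonneg _) (fun s => ?_) hlim
    have hD := (MeasurableSet.iUnion hA).diff (hfin s)
    have hsplit : indicatorOp P L (MeasurableSet.iUnion hA)
        = indicatorOp P L (hfin s) + indicatorOp P L hD := by
      rw [← indicatorOp_union P L (hfin s) hD Set.disjoint_sdiff_right]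
      congr 1
      rw [Set.union_sdiff_cancel (Set.iUnion₂_subset fun i _ => Set.subset_iUnion A i)]
    rw [hsum, hsplit, sub_add_cancel_left, norm_neg]
    exact norm_indicatorOp_le P L hD

/-- The measure `m_L` is given by `m_L(A) u = L (1_A u)`. -/
theorem opMeasure_apply (P : Measure Ω) [IsProbabilityMeasure P] (L : Lp H 2 P →L[ℝ] U)
    {A : Set Ω} (hA : MeasurableSet A) (u : H) :
    opMeasure P L A u = L (indicatorConstLp 2 hA (measure_ne_top P A) u) := by
  have : opMeasure P L A = indicatorOp P L hA := dif_pos hA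
  rw [this, indicatorOp_apply]

/-- The class `G ∈ L²(H, μ; L(H, U))` is an L-derivative `∂_μ f(μ)` of `f` at `μ`:
`D f̂(X) Y = 𝔼[G(X) Y]` for all `X` with law `μ` and all `Y` in `L²(Ω, H)`. -/
def IsLDerivative [MeasurableSpace H] [BorelSpace H] (P : Measure Ω) [IsProbabilityMeasure P]
    (f : P2 H → U) (μ : P2 H) (G : Lp (H →L[ℝ] U) 2 μ.1) : Prop :=
  ∀ X : Lp H 2 P, law P X = μ → ∀ Y : Lp H 2 P,
    fderiv ℝ (lift P f) X Y = ∫ ω, G (X ω) (Y ω) ∂P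

end

end LionsDeriv

end

/-! The derivative is computed first at random variables `Z` with finitely many values. If `A`, `A'`
lie in one level set `B` of `Z` and have equal probability, then `Z + t 1_A u` and `Z + t 1_{A'} u`
have the same law for every `t`, so the derivative of the lift at `Z` in direction `1_A u` depends
on `A` only through `P(A)`. It is additive in `A` and of order `√P(A)`, and on an atomless space the
subsets of `B` realise every probability up to `P(B)`. Hence the associated vector measure is
proportional to `P` on `B` (`vectorMeasure_eq_smul`). For simple `φ`, the derivative at `φ(X)`
therefore has a density `ψ(X)`, with `ψ` depending only on the law of `X`
(`exists_density_of_simpleFunc`).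

The 2-variation norm of an operator with a density is the `L²`-norm of that density
(`twoVariation_densityOp`). Approximate the identity of `H` in `L²(μ)` by simple `φ n`. Then `φ n
(X) → X` in `L²(Ω, H)`, and continuity of the derivative in 2-variation makes the densities `ψ n`
Cauchy in `L²(μ)`. Their limit `g` gives the density `g(X)` at every `X` of law `μ` simultaneously
(`exists_density`).

All assertions then follow from this representation: the vector integrals by
`integral_opMeasure_eq`, conditioning on `X` because `g(X)` is a function of `X`, and the
Radon–Nikodym property by `map_opMeasure_densityOp`. Uniqueness of the L-derivative also needs some
`X` of law `μ`, supplied by a quantile transform (`exists_law_eq`). -/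

noncomputable section

namespace LionsDeriv

/-! ### Atomless spaces: sets of prescribed probability and random variables of prescribed law -/

section Atomless

theorem measure_singleton_of_atomless {Ω : Type*} [MeasurableSpace Ω] {P : Measure Ω}
    (hP : Atomless P) {ω : Ω} (hω : MeasurableSet {ω}) : P {ω} = 0 := by
  by_contra h
  obtain ⟨B, hB, -, hB0, hB1⟩ := hP {ω} hω (pos_iff_ne_zero.2 h)
  rcases Set.subset_singleton_iff_eq.1 hB with rfl | rfl
  · simp at hB0
  · exact lt_irrefl _ hB1

theorem exists_measurable_injective_real (Ω : Type*) [TopologicalSpace Ω] [PolishSpace Ω]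
    [MeasurableSpace Ω] [BorelSpace Ω] : ∃ ξ : Ω → ℝ, Measurable ξ ∧ Function.Injective ξ :=
  ⟨_, measurable_embeddingReal Ω, (measurableEmbedding_embeddingReal Ω).injective⟩

/-- On a Polish space, an atomless measure on a σ-field containing the Borel sets admits a real
random variable with diffuse law. -/
theorem exists_measurable_preimage_singleton_null {Ω : Type*} [TopologicalSpace Ω] [PolishSpace Ω]
    [MeasurableSpace Ω] [OpensMeasurableSpace Ω] {P : Measure Ω} (hP : Atomless P) :
    ∃ ξ : Ω → ℝ, Measurable ξ ∧ ∀ t, P (ξ ⁻¹' {t}) = 0 := by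
  -- The given σ-field may be larger than the Borel one, so the injection is taken Borel measurable.
  -- Its fibres are empty or single points, which are null.
  obtain ⟨ξ, hξ, hinj⟩ := @exists_measurable_injective_real Ω _ _ (borel Ω)
    (@BorelSpace.mk Ω _ (borel Ω) rfl)
  refine ⟨ξ, hξ.mono OpensMeasurableSpace.borel_le le_rfl, fun t => ?_⟩
  have hs := Set.Subsingleton.preimage (Set.subsingleton_singleton (a := t)) hinj
  rcases hs.eq_empty_or_singleton with h | ⟨ω, h⟩
  · rw [h, measure_empty]
  · rw [h]
    exact measure_singleton_of_atomless hP (measurableSet_singleton ω)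

variable {Ω : Type*} [MeasurableSpace Ω] {P : Measure Ω} [IsProbabilityMeasure P] {ξ : Ω → ℝ}

/-- Dominated convergence: away from the null set `ξ = t₀`, the indicator is locally constant in `t`
near `t₀`. -/
theorem continuous_measureReal_inter_preimage_Iic (hξ : Measurable ξ)
    (h0 : ∀ t, P (ξ ⁻¹' {t}) = 0) {A : Set Ω} (hA : MeasurableSet A) :
    Continuous fun t => P.real (A ∩ ξ ⁻¹' Set.Iic t) := by
  have hm : ∀ t, MeasurableSet (A ∩ ξ ⁻¹' Set.Iic t) := fun t => hA.inter (hξ measurableSet_Iic)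
  have key : Continuous fun t => ∫ ω, (A ∩ ξ ⁻¹' Set.Iic t).indicator (fun _ => (1 : ℝ)) ω ∂P := by
    rw [continuous_iff_continuousAt]
    intro t₀
    refine continuousAt_of_dominated (bound := fun _ => 1)
      (Eventually.of_forall fun t => (measurable_const.indicator (hm t)).aestronglyMeasurable)
      (Eventually.of_forall fun t => Eventually.of_forall fun ω => ?_) (integrable_const _) ?_
    · exact (norm_indicator_le_norm_self _ _).trans (by simp)
    · have : ∀ᵐ ω ∂P, ξ ω ≠ t₀ := by
        rw [ae_iff]
        simp only [not_not]
        exact h0 t₀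
      filter_upwards [this] with ω hω
      rcases lt_or_gt_of_ne hω with h | h
      · refine (continuousAt_const (y := A.indicator (fun _ => (1 : ℝ)) ω)).congr ?_
        filter_upwards [lt_mem_nhds h] with t ht
        by_cases hωA : ω ∈ A <;> simp [Set.indicator, hωA, ht.le]
      · refine (continuousAt_const (y := (0 : ℝ))).congr ?_
        filter_upwards [gt_mem_nhds h] with t ht
        simp [Set.indicator, ht]
  refine key.congr fun t => ?_
  rw [integral_indicator (hm t)]
  simp

/-- Intermediate value theorem, between the limits `0` at `-∞` and `P(A)` at `+∞`. -/
theorem exists_measureReal_inter_preimage_Iic_eq (hξ : Measurable ξ)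
    (h0 : ∀ t, P (ξ ⁻¹' {t}) = 0) {A : Set Ω} (hA : MeasurableSet A) {s : ℝ} (hs : 0 < s)
    (hsA : s < P.real A) : ∃ t, P.real (A ∩ ξ ⁻¹' Set.Iic t) = s := by
  have hm : ∀ t, MeasurableSet (A ∩ ξ ⁻¹' Set.Iic t) := fun t => hA.inter (hξ measurableSet_Iic)
  have hmono : Monotone fun t => A ∩ ξ ⁻¹' Set.Iic t := fun a b hab =>
    Set.inter_subset_inter_right _ (Set.preimage_mono (Set.Iic_subset_Iic.2 hab))
  have htop : Tendsto (fun t => P.real (A ∩ ξ ⁻¹' Set.Iic t)) atTop (𝓝 (P.real A)) := by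
    have h := tendsto_measure_iUnion_atTop (μ := P) hmono
    rw [← Set.inter_iUnion, ← Set.preimage_iUnion, Set.iUnion_Iic, Set.preimage_univ,
      Set.inter_univ] at h
    exact (ENNReal.tendsto_toReal (measure_ne_top P A)).comp h
  have hbot : Tendsto (fun t => P.real (A ∩ ξ ⁻¹' Set.Iic t)) atBot (𝓝 0) := by
    have h := tendsto_measure_iInter_atBot (μ := P) (fun t => (hm t).nullMeasurableSet) hmono
      ⟨0, measure_ne_top P _⟩
    rw [← Set.inter_iInter, ← Set.preimage_iInter, iInter_Iic_eq_empty_iff.2 (by simp),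
      Set.preimage_empty, Set.inter_empty, measure_empty] at h
    exact (ENNReal.tendsto_toReal ENNReal.zero_ne_top).comp h
  obtain ⟨a, ha⟩ := (hbot.eventually (gt_mem_nhds hs)).exists
  obtain ⟨b, hb⟩ := (htop.eventually (lt_mem_nhds hsA)).exists
  exact mem_range_of_exists_le_of_exists_ge
    (continuous_measureReal_inter_preimage_Iic hξ h0 hA) ⟨a, ha.le⟩ ⟨b, hb.le⟩

theorem exists_subset_measureReal_eq (hξ : Measurable ξ) (h0 : ∀ t, P (ξ ⁻¹' {t}) = 0)
    {A : Set Ω} (hA : MeasurableSet A) {s : ℝ} (hs : 0 ≤ s) (hsA : s ≤ P.real A) :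
    ∃ B ⊆ A, MeasurableSet B ∧ P.real B = s := by
  rcases hs.eq_or_lt with rfl | hs
  · exact ⟨∅, Set.empty_subset _, MeasurableSet.empty, by simp⟩
  rcases hsA.eq_or_lt with rfl | hsA
  · exact ⟨A, subset_rfl, hA, rfl⟩
  obtain ⟨t, ht⟩ := exists_measureReal_inter_preimage_Iic_eq hξ h0 hA hs hsA
  exact ⟨_, Set.inter_subset_left, hA.inter (hξ measurableSet_Iic), ht⟩

/-- The distribution function of a random variable with diffuse law transforms it into a uniform
one. -/
theorem exists_measurable_map_eq_volume (hξ : Measurable ξ) (h0 : ∀ t, P (ξ ⁻¹' {t}) = 0) :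
    ∃ η : Ω → unitInterval, Measurable η ∧ P.map η = volume := by
  let F : ℝ → ℝ := fun t => P.real (ξ ⁻¹' Set.Iic t)
  have hFmono : Monotone F := fun a b hab =>
    measureReal_mono (Set.preimage_mono (Set.Iic_subset_Iic.2 hab))
  have hF : ∀ t, F t ∈ unitInterval := fun t => ⟨measureReal_nonneg, measureReal_le_one⟩
  let η : Ω → unitInterval := fun ω => ⟨F (ξ ω), hF _⟩
  have hη : Measurable η := (hFmono.measurable.comp hξ).subtype_mk
  have hex : ∀ s, 0 < s → s < 1 → ∃ t, F t = s := fun s hs hs1 => by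
    simpa using exists_measureReal_inter_preimage_Iic_eq hξ h0 MeasurableSet.univ hs (by simpa)
  have hle : ∀ s : ℝ, 0 < s → s < 1 → s ≤ P.real {ω | F (ξ ω) ≤ s} := fun s hs hs1 => by
    obtain ⟨t, rfl⟩ := hex s hs hs1
    exact measureReal_mono fun ω hω => hFmono hω
  have hlt : ∀ s : ℝ, 0 < s → s < 1 → P.real {ω | F (ξ ω) < s} ≤ s := fun s hs hs1 => by
    obtain ⟨t, rfl⟩ := hex s hs hs1
    exact measureReal_mono fun ω hω => (hFmono.reflect_lt hω).le
  -- The closed sublevel set lies in the open one at any `r > s`, of mass at most `r`; then `r`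
  -- decreases to `s`.
  have hge : ∀ s : ℝ, 0 ≤ s → s < 1 → P.real {ω | F (ξ ω) ≤ s} ≤ s := fun s hs hs1 => by
    refine le_of_forall_gt_imp_ge_of_dense fun r hr => ?_
    rcases lt_or_ge r 1 with hr1 | hr1
    · exact (measureReal_mono fun ω (hω : F (ξ ω) ≤ s) => lt_of_le_of_lt hω hr).trans
        (hlt r (hs.trans_lt hr) hr1)
    · exact measureReal_le_one.trans hr1
  have hPη : IsProbabilityMeasure (P.map η) := Measure.isProbabilityMeasure_map hη.aemeasurable
  refine ⟨η, hη, Measure.ext_of_Iic _ _ fun s => ?_⟩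
  rw [Measure.map_apply hη measurableSet_Iic, unitInterval.volume_Iic,
    ← ofReal_measureReal (measure_ne_top _ _)]
  congr 1
  have h0' := s.2.1
  change P.real {ω | F (ξ ω) ≤ s} = s
  rcases s.2.2.lt_or_eq with hs1 | hs1
  · refine le_antisymm (hge s h0' hs1) ?_
    rcases h0'.lt_or_eq with hs0 | hs0
    · exact hle s hs0 hs1
    · exact hs0 ▸ measureReal_nonneg
  · have : {ω | F (ξ ω) ≤ 1} = Set.univ := Set.eq_univ_of_forall fun ω => (hF _).2
    rw [hs1, this, probReal_univ]

/-- Every law in `𝒫₂(H)` is attained on an atomless space. -/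
theorem exists_law_eq {H : Type*} [NormedAddCommGroup H] [CompleteSpace H]
    [TopologicalSpace.SeparableSpace H] [MeasurableSpace H] [BorelSpace H]
    (hξ : Measurable ξ) (h0 : ∀ t, P (ξ ⁻¹' {t}) = 0) (μ : P2 H) :
    ∃ X : Lp H 2 P, law P X = μ := by
  have := UniformSpace.secondCountable_of_separable H
  have := μ.2.1
  obtain ⟨η, hη, hmap⟩ := exists_measurable_map_eq_volume hξ h0
  -- `k` plays the role of a quantile function: it sends the uniform law on the unit interval to
  -- `μ`.
  obtain ⟨k, hk, hkμ⟩ := Measure.exists_measurable_map_eq μ.1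
  have hX : P.map (k ∘ η) = μ.1 := by rw [← Measure.map_map hk hη, hmap, hkμ]
  have hL : MemLp (k ∘ η) 2 P := by
    refine ⟨(hk.comp hη).aestronglyMeasurable, ?_⟩
    rw [eLpNorm_lt_top_iff_lintegral_rpow_enorm_lt_top (by simp) (by simp)]
    have h := μ.2.2
    rw [← hX, lintegral_map (by fun_prop) (hk.comp hη)] at h
    simpa using h
  refine ⟨hL.toLp _, Subtype.ext ?_⟩
  change P.map (hL.toLp _) = μ.1
  rw [Measure.map_congr hL.coeFn_toLp, hX]

end Atomless

/-! ### The 2-variation norm and operators with a density -/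

section TwoVariation

variable {Ω H U : Type*} [MeasurableSpace Ω] {P : Measure Ω} [IsProbabilityMeasure P]
  [NormedAddCommGroup H] [InnerProductSpace ℝ H]
  [NormedAddCommGroup U] [InnerProductSpace ℝ U]

/-- An operator on `L²(Ω, H)` is determined by its values on indicators. -/
theorem clm_ext_indicator {L L' : Lp H 2 P →L[ℝ] U}
    (h : ∀ (A : Set Ω) (hA : MeasurableSet A) (u : H),
      L (indicatorConstLp 2 hA (measure_ne_top P A) u)
        = L' (indicatorConstLp 2 hA (measure_ne_top P A) u)) : L = L' := by
  ext Y
  induction Y using Lp.induction (ENNReal.ofNat_ne_top (n := 2)) with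
  | indicatorConst c hs hμs => exact h _ hs c
  | add hf hg _ h1 h2 => rw [map_add, map_add, h1, h2]
  | isClosed => exact isClosed_eq L.continuous L'.continuous

omit [IsProbabilityMeasure P] in
theorem indicatorConstLp_smul (c : ℝ) {A : Set Ω} (hA : MeasurableSet A) (hPA : P A ≠ ∞) (u : H) :
    indicatorConstLp 2 hA hPA (c • u) = c • indicatorConstLp 2 hA hPA u := by
  apply Lp.ext
  filter_upwards [indicatorConstLp_coeFn (p := 2) (hs := hA) (hμs := hPA) (c := c • u),
    Lp.coeFn_smul c (indicatorConstLp 2 hA hPA u),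
    indicatorConstLp_coeFn (p := 2) (hs := hA) (hμs := hPA) (c := u)] with ω h1 h2 h3
  rw [h1, h2, Pi.smul_apply, h3]
  by_cases hω : ω ∈ A <;> simp [hω]

theorem sum_enorm_indicator {Ω H ι : Type*} [NormedAddCommGroup H] [Fintype ι] {A : ι → Set Ω}
    (hd : Pairwise fun i j => Disjoint (A i) (A j)) (x : ι → H) (ω : Ω) :
    ∑ i, ‖(A i).indicator (fun _ => x i) ω‖ₑ = ‖∑ i, (A i).indicator (fun _ => x i) ω‖ₑ := by
  by_cases h : ∃ i, ω ∈ A i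
  · obtain ⟨i, hi⟩ := h
    have h0 : ∀ j ≠ i, (A j).indicator (fun _ => x j) ω = 0 := fun j hj =>
      Set.indicator_of_notMem (Set.disjoint_right.1 (hd hj) hi) _
    rw [Fintype.sum_eq_single i h0, Fintype.sum_eq_single i fun j hj => by rw [h0 j hj, enorm_zero]]
  · push Not at h
    simp [h]

/-- The bound defining the 2-variation norm, in homogeneous form. -/
theorem sum_enorm_le_twoVariation (L : Lp H 2 P →L[ℝ] U) {ι : Type*} [Fintype ι] {A : ι → Set Ω}
    (hA : ∀ i, MeasurableSet (A i)) (hd : Pairwise fun i j => Disjoint (A i) (A j)) (x : ι → H)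
    {c : ℝ} (hc : 0 < c)
    (hx : ∫⁻ ω, ‖∑ i, (A i).indicator (fun _ => x i) ω‖ₑ ^ 2 ∂P ≤ ENNReal.ofReal c ^ 2) :
    ∑ i, ‖L (indicatorConstLp 2 (hA i) (measure_ne_top P (A i)) (x i))‖ₑ
      ≤ ENNReal.ofReal c * twoVariation P L := by
  have hc0 : ENNReal.ofReal c ≠ 0 := by simpa using hc
  have hce : ‖c⁻¹‖ₑ = (ENNReal.ofReal c)⁻¹ := by
    rw [Real.enorm_eq_ofReal (by positivity), ENNReal.ofReal_inv_of_pos hc]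
  rw [mul_comm, ← ENNReal.div_le_iff_le_mul (Or.inl hc0) (Or.inl ENNReal.ofReal_ne_top),
    div_eq_mul_inv, ← hce, Finset.sum_mul]
  let e := Fintype.equivFin ι
  have h1 : ∑ i, ‖L (indicatorConstLp 2 (hA i) (measure_ne_top P (A i)) (x i))‖ₑ * ‖c⁻¹‖ₑ
      = ∑ k, ‖L (indicatorConstLp 2 (hA (e.symm k)) (measure_ne_top P (A (e.symm k)))
          (c⁻¹ • x (e.symm k)))‖ₑ := by
    rw [← e.symm.sum_comp]
    refine Finset.sum_congr rfl fun k _ => ?_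
    rw [indicatorConstLp_smul, map_smul, enorm_smul, mul_comm]
  rw [h1]
  refine le_iSup_of_le _ (le_iSup_of_le (fun k => A (e.symm k)) (le_iSup_of_le
    (fun k => c⁻¹ • x (e.symm k)) (le_iSup_of_le (fun k => hA _) (le_iSup_of_le
      (fun j k hjk => hd (e.symm.injective.ne hjk)) (le_iSup_of_le ?_ le_rfl)))))
  have h2 : ∀ ω, ‖∑ k, (A (e.symm k)).indicator (fun _ => c⁻¹ • x (e.symm k)) ω‖ₑ ^ 2
      = ‖c⁻¹‖ₑ ^ 2 * ‖∑ i, (A i).indicator (fun _ => x i) ω‖ₑ ^ 2 := fun ω => by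
    rw [e.symm.sum_comp fun i => (A i).indicator (fun _ => c⁻¹ • x i) ω, ← mul_pow, ← enorm_smul,
      Finset.smul_sum]
    congr 2
    refine Finset.sum_congr rfl fun i _ => ?_
    by_cases hω : ω ∈ A i <;> simp [hω]
  simp_rw [h2]
  rw [lintegral_const_mul' _ _ (by simp), hce, ← ENNReal.inv_pow, mul_comm, ← div_eq_mul_inv]
  exact ENNReal.div_le_of_le_mul (by simpa using hx)

/-- A step function with a single term is admissible after scaling. This turns convergence in
2-variation into convergence on indicators, which suffices to identify an operator. -/
theorem enorm_indicator_le_twoVariation (L : Lp H 2 P →L[ℝ] U) {A : Set Ω} (hA : MeasurableSet A)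
    (u : H) : ‖L (indicatorConstLp 2 hA (measure_ne_top P A) u)‖ₑ ≤ ‖u‖ₑ * twoVariation P L := by
  rcases eq_or_ne u 0 with rfl | hu
  · have : indicatorConstLp 2 hA (measure_ne_top P A) (0 : H) = 0 := by
      simpa using indicatorConstLp_smul (P := P) 0 hA (measure_ne_top P A) (0 : H)
    simp [this]
  have h := sum_enorm_le_twoVariation L (ι := Unit) (A := fun _ => A) (fun _ => hA)
    (fun i j hij => (hij rfl).elim) (fun _ => u) (norm_pos_iff.2 hu) (by
      refine (lintegral_mono (g := fun _ => ENNReal.ofReal ‖u‖ ^ 2) fun ω => ?_).trans (by simp)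
      rw [ofReal_norm]
      refine pow_le_pow_left' ?_ 2
      simpa using enorm_indicator_le_enorm_self (fun _ => u) ω)
  simpa [ofReal_norm] using h

theorem twoVariation_sub_le (L L' : Lp H 2 P →L[ℝ] U) :
    twoVariation P (L - L') ≤ twoVariation P L + twoVariation P L' := by
  refine iSup_le fun n => iSup_le fun A => iSup_le fun x => iSup_le fun hA => iSup_le fun hd =>
    iSup_le fun hx => ?_
  have h := fun M => sum_enorm_le_twoVariation (P := P) (U := U) M hA hd x one_pos
    (by simpa using hx)
  simp only [ENNReal.ofReal_one, one_mul] at h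
  calc _ ≤ ∑ i, (‖L (indicatorConstLp 2 (hA i) (measure_ne_top P (A i)) (x i))‖ₑ
        + ‖L' (indicatorConstLp 2 (hA i) (measure_ne_top P (A i)) (x i))‖ₑ) :=
        Finset.sum_le_sum fun i _ => enorm_sub_le
    _ ≤ _ := by
        rw [Finset.sum_add_distrib]
        exact add_le_add (h L) (h L')

variable [CompleteSpace U]

/-- The operator `Y ↦ 𝔼[G Y]` on `L²(Ω, H)` with density `G ∈ L²(Ω; L(H, U))`. -/
def densityOp (P : Measure Ω) (G : Lp (H →L[ℝ] U) 2 P) : Lp H 2 P →L[ℝ] U :=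
  (ContinuousLinearMap.id ℝ (H →L[ℝ] U)).lpPairing P 2 2 G

omit [IsProbabilityMeasure P] in
theorem densityOp_apply (G : Lp (H →L[ℝ] U) 2 P) (Y : Lp H 2 P) :
    densityOp P G Y = ∫ ω, G ω (Y ω) ∂P :=
  ContinuousLinearMap.lpPairing_eq_integral _ G Y

omit [IsProbabilityMeasure P] in
theorem densityOp_sub (G G' : Lp (H →L[ℝ] U) 2 P) :
    densityOp P (G - G') = densityOp P G - densityOp P G' := by
  simp [densityOp]

theorem densityOp_indicator (G : Lp (H →L[ℝ] U) 2 P) {A : Set Ω} (hA : MeasurableSet A) (u : H) :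
    densityOp P G (indicatorConstLp 2 hA (measure_ne_top P A) u) = ∫ ω in A, G ω u ∂P := by
  rw [densityOp_apply, ← integral_indicator hA]
  refine integral_congr_ae ?_
  filter_upwards [indicatorConstLp_coeFn (p := 2) (hs := hA) (hμs := measure_ne_top P A) (c := u)]
    with ω hω
  rw [hω]
  by_cases h : ω ∈ A <;> simp [h]

theorem integrable_Lp_two {E : Type*} [NormedAddCommGroup E] (G : Lp E 2 P) : Integrable G P :=
  (Lp.memLp G).integrable (by norm_num)

omit [IsProbabilityMeasure P] in
theorem eLpNorm_two_eq {E : Type*} [NormedAddCommGroup E] (f : Ω → E) :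
    eLpNorm f 2 P = (∫⁻ ω, ‖f ω‖ₑ ^ 2 ∂P) ^ (1 / 2 : ℝ) := by
  simp [eLpNorm_eq_lintegral_rpow_enorm_toReal]

/-- Disjointness turns the sum of norms into the norm of the step function; Cauchy–Schwarz does the
rest. -/
theorem twoVariation_densityOp_le (G : Lp (H →L[ℝ] U) 2 P) :
    twoVariation P (densityOp P G) ≤ eLpNorm G 2 P := by
  refine iSup_le fun n => iSup_le fun A => iSup_le fun x => iSup_le fun hA => iSup_le fun hd =>
    iSup_le fun hx => ?_
  have hmeas : Measurable fun ω => ‖∑ i, (A i).indicator (fun _ => x i) ω‖ₑ := by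
    simp_rw [← sum_enorm_indicator hd]
    refine Finset.measurable_sum _ fun i _ => ?_
    exact (StronglyMeasurable.indicator stronglyMeasurable_const (hA i)).enorm
  calc ∑ i, ‖densityOp P G (indicatorConstLp 2 (hA i) (measure_ne_top P (A i)) (x i))‖ₑ
      ≤ ∑ i, ∫⁻ ω, ‖G ω‖ₑ * ‖(A i).indicator (fun _ => x i) ω‖ₑ ∂P := by
        refine Finset.sum_le_sum fun i _ => ?_
        rw [densityOp_indicator]
        refine (enorm_integral_le_lintegral_enorm _).trans ?_
        rw [← lintegral_indicator (hA i)]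
        refine lintegral_mono fun ω => ?_
        by_cases h : ω ∈ A i
        · simpa [h] using (G ω).le_opENorm (x i)
        · simp [h]
    _ = ∫⁻ ω, ‖G ω‖ₑ * ‖∑ i, (A i).indicator (fun _ => x i) ω‖ₑ ∂P := by
        simp_rw [← sum_enorm_indicator hd, Finset.mul_sum]
        refine (lintegral_finsetSum _ fun i _ => ?_).symm
        exact (Lp.stronglyMeasurable G).enorm.mul
          (StronglyMeasurable.indicator stronglyMeasurable_const (hA i)).enorm
    _ ≤ (∫⁻ ω, ‖G ω‖ₑ ^ (2 : ℝ) ∂P) ^ (1 / 2 : ℝ)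
        * (∫⁻ ω, ‖∑ i, (A i).indicator (fun _ => x i) ω‖ₑ ^ (2 : ℝ) ∂P) ^ (1 / 2 : ℝ) :=
        ENNReal.lintegral_mul_le_Lp_mul_Lq P Real.HolderConjugate.two_two
          (Lp.stronglyMeasurable G).enorm.aemeasurable hmeas.aemeasurable
    _ ≤ eLpNorm G 2 P * 1 := by
        rw [eLpNorm_two_eq]
        simp only [ENNReal.rpow_two]
        gcongr
        exact (ENNReal.rpow_le_rpow hx (by norm_num)).trans (by simp)
    _ = _ := mul_one _

/-- For a simple density the 2-variation norm is attained by step functions. -/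
theorem eLpNorm_le_twoVariation_of_simpleFunc (S : SimpleFunc Ω (H →L[ℝ] U)) (hS : MemLp S 2 P) :
    eLpNorm S 2 P ≤ twoVariation P (densityOp P (hS.toLp S)) := by
  have hN := hS.eLpNorm_ne_top
  rcases eq_or_ne (eLpNorm S 2 P) 0 with h0 | h0
  · simp [h0]
  have hsq : eLpNorm S 2 P ^ 2 = ∫⁻ ω, ‖S ω‖ₑ ^ 2 ∂P := by
    rw [eLpNorm_two_eq, ← ENNReal.rpow_two, ← ENNReal.rpow_mul]
    simp
  have hsum : ∫⁻ ω, ‖S ω‖ₑ ^ 2 ∂P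
      = ∑ T : S.range, ‖(T : H →L[ℝ] U)‖ₑ ^ 2 * P (S ⁻¹' {(T : H →L[ℝ] U)}) := by
    rw [Finset.sum_coe_sort S.range fun T : H →L[ℝ] U => ‖T‖ₑ ^ 2 * P (S ⁻¹' {T}),
      ← SimpleFunc.map_lintegral (fun T : H →L[ℝ] U => ‖T‖ₑ ^ 2) S,
      ← SimpleFunc.lintegral_eq_lintegral]
    rfl
  -- The factor `a < 1` is needed because an operator norm need not be attained on the unit ball.
  refine ENNReal.le_of_forall_lt_one_mul_le fun a ha => ?_
  have hu : ∀ T : H →L[ℝ] U, ∃ u : H, ‖u‖ₑ ≤ 1 ∧ a * ‖T‖ₑ ≤ ‖T u‖ₑ := fun T => by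
    rcases eq_or_ne T 0 with rfl | hT
    · exact ⟨0, by simp, by simp [← ofReal_norm]⟩
    have ha' : a.toReal < 1 := by
      simpa using (ENNReal.toReal_lt_toReal ha.ne_top ENNReal.one_ne_top).2 ha
    obtain ⟨u, hu1, hu2⟩ := T.exists_lt_apply_of_lt_opNorm
      (mul_lt_of_lt_one_left (norm_pos_iff.2 hT) ha')
    refine ⟨u, ?_, ?_⟩
    · rw [← ofReal_norm, ← ENNReal.ofReal_one]
      exact ENNReal.ofReal_le_ofReal hu1.le
    · rw [← ofReal_norm, ← ofReal_norm, ← ENNReal.ofReal_toReal ha.ne_top,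
        ← ENNReal.ofReal_mul ENNReal.toReal_nonneg]
      exact ENNReal.ofReal_le_ofReal hu2.le
  choose u hu1 hu2 using hu
  have hA : ∀ T : S.range, MeasurableSet (S ⁻¹' {(T : H →L[ℝ] U)}) := fun T =>
    S.measurableSet_fiber T
  have hd : Pairwise fun T T' : S.range =>
      Disjoint (S ⁻¹' {(T : H →L[ℝ] U)}) (S ⁻¹' {(T' : H →L[ℝ] U)}) := fun T T' h =>
    Disjoint.preimage _ (by simpa using Subtype.coe_ne_coe.2 h)
  have hc := ENNReal.toReal_pos h0 hN
  -- The test step function is `‖S‖ u(S)`, the equality case of Cauchy–Schwarz up to `a`: its norm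
  -- is at most `‖S‖` pointwise, while on each fibre `S` maps it to a vector of norm at least `a
  -- ‖S‖²`.
  have key := sum_enorm_le_twoVariation (densityOp P (hS.toLp S)) hA hd
    (fun T => ‖(T : H →L[ℝ] U)‖ • u T) hc (by
      rw [ENNReal.ofReal_toReal hN, hsq]
      refine lintegral_mono fun ω => pow_le_pow_left' ?_ 2
      have h1 : ∑ T : S.range, (S ⁻¹' {(T : H →L[ℝ] U)}).indicator
          (fun _ => ‖(T : H →L[ℝ] U)‖ • u T) ω = ‖S ω‖ • u (S ω) :=
        (Fintype.sum_eq_single (⟨S ω, S.mem_range_self ω⟩ : S.range) fun T hT =>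
          Set.indicator_of_notMem (show ω ∉ S ⁻¹' {(T : H →L[ℝ] U)} from
            fun h => hT (Subtype.ext (Eq.symm h))) _).trans
          (Set.indicator_of_mem (show ω ∈ S ⁻¹' {S ω} from rfl) _)
      rw [h1, enorm_smul, enorm_norm]
      exact mul_le_of_le_one_right' (hu1 _))
  rw [ENNReal.ofReal_toReal hN] at key
  have hterm : ∀ T : S.range, a * (‖(T : H →L[ℝ] U)‖ₑ ^ 2 * P (S ⁻¹' {(T : H →L[ℝ] U)}))
      ≤ ‖densityOp P (hS.toLp S) (indicatorConstLp 2 (hA T) (measure_ne_top P _)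
          (‖(T : H →L[ℝ] U)‖ • u T))‖ₑ := fun T => by
    have hint : ∫ ω in S ⁻¹' {(T : H →L[ℝ] U)}, hS.toLp S ω (‖(T : H →L[ℝ] U)‖ • u T) ∂P
        = P.real (S ⁻¹' {(T : H →L[ℝ] U)}) • ‖(T : H →L[ℝ] U)‖ • (T : H →L[ℝ] U) (u T) := by
      rw [← map_smul, ← setIntegral_const]
      refine setIntegral_congr_ae (hA T) ?_
      filter_upwards [hS.coeFn_toLp] with ω hω hωT
      rw [hω, show S ω = T from hωT]
    rw [densityOp_indicator, hint, enorm_smul, enorm_smul, enorm_norm,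
      Real.enorm_eq_ofReal measureReal_nonneg, ofReal_measureReal]
    calc _ = P (S ⁻¹' {(T : H →L[ℝ] U)}) * (‖(T : H →L[ℝ] U)‖ₑ * (a * ‖(T : H →L[ℝ] U)‖ₑ)) := by
          ring
      _ ≤ _ := by
          gcongr
          exact hu2 _
  have hfin : eLpNorm S 2 P * (a * eLpNorm S 2 P)
      ≤ eLpNorm S 2 P * twoVariation P (densityOp P (hS.toLp S)) := by
    refine le_trans (le_of_eq ?_) ((Finset.sum_le_sum fun T _ => hterm T).trans key)
    rw [← Finset.mul_sum, ← hsum, ← hsq]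
    ring
  exact (ENNReal.mul_le_mul_iff_right h0 hN).1 hfin

omit [IsProbabilityMeasure P] in
theorem eLpNorm_sub_toLp {E : Type*} [NormedAddCommGroup E] (G : Lp E 2 P) {S : Ω → E}
    (hS : MemLp S 2 P) : eLpNorm (G - hS.toLp S : Lp E 2 P) 2 P = eLpNorm (⇑G - S) 2 P := by
  refine eLpNorm_congr_ae ?_
  filter_upwards [Lp.coeFn_sub G (hS.toLp S), hS.coeFn_toLp] with ω h1 h2
  rw [h1, Pi.sub_apply, h2, Pi.sub_apply]

omit [IsProbabilityMeasure P] in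
theorem eLpNorm_le_add_eLpNorm_sub {E : Type*} [NormedAddCommGroup E] (G : Lp E 2 P) {S : Ω → E}
    (hS : MemLp S 2 P) : eLpNorm G 2 P ≤ eLpNorm S 2 P + eLpNorm (⇑G - S) 2 P := by
  calc eLpNorm G 2 P = eLpNorm (S + (⇑G - S)) 2 P := by congr 1; simp
    _ ≤ _ := eLpNorm_add_le hS.1 ((Lp.aestronglyMeasurable G).sub hS.1) (by norm_num)

/-- The 2-variation norm of an operator with a density is the `L²`-norm of the density. -/
theorem twoVariation_densityOp (G : Lp (H →L[ℝ] U) 2 P) :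
    twoVariation P (densityOp P G) = eLpNorm G 2 P := by
  refine le_antisymm (twoVariation_densityOp_le G) ?_
  refine ENNReal.le_of_forall_pos_le_add fun ε hε _ => ?_
  have hε2 : (ε / 2 : ℝ≥0∞) ≠ 0 := by simpa using hε.ne'
  obtain ⟨S, hGS, hS⟩ := (Lp.memLp G).exists_simpleFunc_eLpNorm_sub_lt (by simp) hε2
  have hsub := eLpNorm_sub_toLp G hS
  calc eLpNorm G 2 P ≤ eLpNorm S 2 P + eLpNorm (⇑G - ⇑S) 2 P := eLpNorm_le_add_eLpNorm_sub G hS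
    _ ≤ (twoVariation P (densityOp P G) + ε / 2) + ε / 2 := by
      refine add_le_add (le_trans (eLpNorm_le_twoVariation_of_simpleFunc S hS) ?_) hGS.le
      have h : densityOp P (hS.toLp S) = densityOp P G - densityOp P (G - hS.toLp S) := by
        rw [densityOp_sub, sub_sub_cancel]
      rw [h]
      refine (twoVariation_sub_le _ _).trans (add_le_add_right ?_ _)
      exact (twoVariation_densityOp_le _).trans (hsub ▸ hGS.le)
    _ = _ := by rw [add_assoc, ENNReal.add_halves]

end TwoVariation

/-! ### Additive functions of the probability are linear -/

section Proportionality

/-- A function on `[0, b]` that is additive and of order `√s` at `0` is linear. -/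
theorem eq_div_smul_of_additive {E : Type*} [NormedAddCommGroup E] [NormedSpace ℝ E] {w : ℝ → E}
    {b C : ℝ} (hb : 0 < b) (hC : 0 ≤ C)
    (hadd : ∀ s t, 0 ≤ s → 0 ≤ t → s + t ≤ b → w (s + t) = w s + w t)
    (hw : ∀ s, 0 ≤ s → s ≤ b → ‖w s‖ ≤ C * √s) {s : ℝ} (hs : 0 ≤ s) (hsb : s ≤ b) :
    w s = (s / b) • w b := by
  have h0 : w 0 = 0 := by simpa using hw 0 le_rfl hb.le
  have hmul : ∀ h, 0 ≤ h → ∀ k : ℕ, k * h ≤ b → w (k * h) = (k : ℝ) • w h := by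
    intro h hh k
    induction k with
    | zero => intro _; simp [h0]
    | succ k ih =>
      intro hk
      push_cast at hk ⊢
      rw [add_mul, one_mul] at hk ⊢
      rw [hadd _ _ (by positivity) hh hk, ih (by linarith), add_smul, one_smul]
  have hbound : ∀ n : ℕ, ‖w s - (s / b) • w b‖
      ≤ 1 / ((n : ℝ) + 1) * ‖w b‖ + C * √(b * (1 / ((n : ℝ) + 1))) := by
    intro n
    have hn : (0 : ℝ) < n + 1 := by positivity
    -- A grid of mesh `b / (n + 1)`: `s` is `k` grid steps plus a remainder shorter than `h`, on
    -- which `w` is at most `C √h`. Letting `n` grow removes both errors.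
    set h : ℝ := b * (1 / ((n : ℝ) + 1)) with hh
    have hhpos : 0 < h := by positivity
    have hbh : b = ((n + 1 : ℕ) : ℝ) * h := by
      rw [hh]; push_cast; field_simp
    have hwb : w b = ((n : ℝ) + 1) • w h := by
      conv_lhs => rw [hbh]
      rw [hmul h hhpos.le (n + 1) hbh.ge]
      push_cast
      rfl
    set k := ⌊s / h⌋₊
    have hk1 : k * h ≤ s := (le_div_iff₀ hhpos).1 (Nat.floor_le (by positivity))
    have hk2 : s < (k + 1) * h := (div_lt_iff₀ hhpos).1 (Nat.lt_floor_add_one _)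
    have hws : w s = (k : ℝ) • w h + w (s - k * h) := by
      rw [← hmul h hhpos.le k (hk1.trans hsb), ← hadd _ _ (by positivity) (by linarith)
        (by linarith)]
      congr 1
      ring
    have hdiff : w s - (s / b) • w b = -((s / h - k) / (n + 1)) • w b + w (s - k * h) := by
      have : (k : ℝ) • w h = (k / ((n : ℝ) + 1)) • w b := by
        rw [hwb, smul_smul]; congr 1; field_simp
      rw [hws, this, add_sub_right_comm, ← sub_smul]
      congr 2
      rw [hbh]; push_cast; field_simp; ring
    rw [hdiff]
    refine (norm_add_le _ _).trans (add_le_add ?_ ?_)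
    · rw [norm_smul, norm_neg, norm_div, Real.norm_of_nonneg hn.le]
      gcongr
      rw [Real.norm_of_nonneg, sub_le_iff_le_add]
      · exact (div_le_iff₀ hhpos).2 (by linarith)
      · rw [sub_nonneg]; exact (le_div_iff₀ hhpos).2 hk1
    · refine (hw _ (by linarith) (by nlinarith)).trans ?_
      gcongr
      linarith
  have hlim : Tendsto (fun n : ℕ => 1 / ((n : ℝ) + 1) * ‖w b‖
      + C * √(b * (1 / ((n : ℝ) + 1)))) atTop (𝓝 0) := by
    have h1 := tendsto_one_div_add_atTop_nhds_zero_nat (𝕜 := ℝ)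
    have h2 := (h1.mul_const ‖w b‖).add ((h1.const_mul b).sqrt.const_mul C)
    simpa using h2
  exact sub_eq_zero.1 (norm_le_zero_iff.1 (ge_of_tendsto' hlim hbound))

variable {Ω : Type*} [MeasurableSpace Ω] {P : Measure Ω} [IsProbabilityMeasure P] {ξ : Ω → ℝ}

/-- A vector measure that on subsets of `B` only depends on their probability is proportional to
`P` there. -/
theorem vectorMeasure_eq_smul {E : Type*} [NormedAddCommGroup E] [NormedSpace ℝ E]
    (hξ : Measurable ξ) (h0 : ∀ t, P (ξ ⁻¹' {t}) = 0) (m : VectorMeasure Ω E) {C : ℝ} (hC : 0 ≤ C)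
    (hm : ∀ A, MeasurableSet A → ‖m A‖ ≤ C * √(P.real A)) {B : Set Ω} (hB : MeasurableSet B)
    (hinv : ∀ A A', MeasurableSet A → MeasurableSet A' → A ⊆ B → A' ⊆ B → P.real A = P.real A' →
      m A = m A') {A : Set Ω} (hA : MeasurableSet A) (hAB : A ⊆ B) :
    m A = (P.real A / P.real B) • m B := by
  rcases (measureReal_nonneg (μ := P) (s := B)).eq_or_lt with hB0 | hB0
  · have hA0 : P.real A = 0 := le_antisymm (hB0 ▸ measureReal_mono hAB) measureReal_nonneg
    simpa [hA0] using hm A hA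
  -- The range conditions on `s` sit inside the existential so that the choice is a total function
  -- of `s`, with `∅` as junk value.
  have hex : ∀ s, ∃ D, 0 ≤ s → s ≤ P.real B → D ⊆ B ∧ MeasurableSet D ∧ P.real D = s := fun s => by
    by_cases hs : 0 ≤ s ∧ s ≤ P.real B
    · obtain ⟨D, hD⟩ := exists_subset_measureReal_eq hξ h0 hB hs.1 hs.2
      exact ⟨D, fun _ _ => hD⟩
    · exact ⟨∅, fun h1 h2 => (hs ⟨h1, h2⟩).elim⟩
  choose D hD using hex
  have hwm : ∀ A, MeasurableSet A → A ⊆ B → m A = m (D (P.real A)) := fun A hA hAB => by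
    obtain ⟨h1, h2, h3⟩ := hD (P.real A) measureReal_nonneg (measureReal_mono hAB)
    exact hinv _ _ hA h2 hAB h1 h3.symm
  rw [hwm A hA hAB, hwm B hB subset_rfl]
  refine eq_div_smul_of_additive (w := fun s => m (D s)) hB0 hC (fun s t hs ht hst => ?_)
    (fun s hs hsB => ?_) measureReal_nonneg (measureReal_mono hAB)
  · obtain ⟨h1, h2, h3⟩ := hD (s + t) (add_nonneg hs ht) hst
    -- The chosen sets need not be nested. Additivity comes from cutting `D (s + t)` into pieces of
    -- mass `s` and `t`, which `m` cannot distinguish from `D s` and `D t`.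
    obtain ⟨D', hD', hmD', hPD'⟩ := exists_subset_measureReal_eq hξ h0 h2 hs (by linarith)
    have h4 : P.real (D (s + t) \ D') = t := by
      rw [measureReal_sdiff hD' hmD', h3, hPD']; ring
    change m (D (s + t)) = m (D s) + m (D t)
    rw [← Set.union_sdiff_cancel hD', VectorMeasure.of_union Set.disjoint_sdiff_right hmD'
      (h2.diff hmD'), hwm D' hmD' (hD'.trans h1), hPD',
      hwm _ (h2.diff hmD') (Set.sdiff_subset.trans h1), h4]
  · obtain ⟨h1, h2, h3⟩ := hD s hs hsB
    simpa [h3] using hm _ h2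

end Proportionality

/-! ### Perturbations that leave the law unchanged -/

section LawInvariance

variable {Ω H U : Type*} [MeasurableSpace Ω] {P : Measure Ω} [IsProbabilityMeasure P]
  [NormedAddCommGroup H] [InnerProductSpace ℝ H] [MeasurableSpace H] [BorelSpace H]
  [NormedAddCommGroup U] [InnerProductSpace ℝ U]

omit [InnerProductSpace ℝ H] in
theorem law_eq_of_ae_eq {X X' : Lp H 2 P} {V V' : Ω → H} (hX : X =ᵐ[P] V) (hX' : X' =ᵐ[P] V')
    (h : P.map V = P.map V') : law P X = law P X' := by
  refine Subtype.ext ?_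
  change P.map X = P.map X'
  rw [Measure.map_congr hX, Measure.map_congr hX', h]

/-- The derivative of a lift at `X` in direction `Y` depends only on the laws of `X + t Y`. -/
theorem fderiv_lift_eq_of_law_eq {f : P2 H → U} (hf : Differentiable ℝ (lift P f))
    {X X' Y Y' : Lp H 2 P} (h : ∀ t : ℝ, law P (X + t • Y) = law P (X' + t • Y')) :
    fderiv ℝ (lift P f) X Y = fderiv ℝ (lift P f) X' Y' := by
  have h1 : HasDerivAt (fun t : ℝ => lift P f (X + t • Y)) (fderiv ℝ (lift P f) X Y) 0 :=
    (hf X).hasFDerivAt.hasLineDerivAt Y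
  have h2 : HasDerivAt (fun t : ℝ => lift P f (X' + t • Y')) (fderiv ℝ (lift P f) X' Y') 0 :=
    (hf X').hasFDerivAt.hasLineDerivAt Y'
  have h3 : (fun t : ℝ => lift P f (X + t • Y)) = fun t => lift P f (X' + t • Y') :=
    funext fun t => congrArg f (h t)
  exact (h3 ▸ h1).unique h2

omit [MeasurableSpace H] [BorelSpace H] in
theorem add_smul_indicator_coeFn {X : Lp H 2 P} {V : Ω → H} (hX : X =ᵐ[P] V) {A : Set Ω}
    (hA : MeasurableSet A) (u : H) (t : ℝ) :
    ⇑(X + t • indicatorConstLp 2 hA (measure_ne_top P A) u)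
      =ᵐ[P] fun ω => V ω + A.indicator (fun _ => t • u) ω := by
  filter_upwards [Lp.coeFn_add X (t • indicatorConstLp 2 hA (measure_ne_top P A) u),
    Lp.coeFn_smul t (indicatorConstLp 2 hA (measure_ne_top P A) u), hX,
    indicatorConstLp_coeFn (p := 2) (hs := hA) (hμs := measure_ne_top P A) (c := u)]
    with ω h1 h2 h3 h4
  rw [h1, Pi.add_apply, h2, Pi.smul_apply, h3, h4]
  by_cases hω : ω ∈ A <;> simp [hω]

omit [InnerProductSpace ℝ H] in
/-- Adding a constant on a subset of a level set changes the law in a way that depends only on the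
probability of the subset. -/
theorem map_add_indicator_eq [SecondCountableTopology H] {V : Ω → H} (hV : Measurable V) {x v : H}
    {A A' : Set Ω}
    (hA : MeasurableSet A) (hA' : MeasurableSet A') (hAx : A ⊆ V ⁻¹' {x}) (hAx' : A' ⊆ V ⁻¹' {x})
    (h : P A = P A') :
    P.map (fun ω => V ω + A.indicator (fun _ => v) ω)
      = P.map (fun ω => V ω + A'.indicator (fun _ => v) ω) := by
  classical
  have hmeas : ∀ {D : Set Ω}, MeasurableSet D →
      Measurable fun ω => V ω + D.indicator (fun _ => v) ω := fun hD =>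
    hV.add (measurable_const.indicator hD)
  ext S hS
  -- As `V` is constant on `D`, the set `D` is either contained in `V ⁻¹' S` or disjoint from it.
  have hrest : ∀ {D : Set Ω}, MeasurableSet D → D ⊆ V ⁻¹' {x} →
      P (V ⁻¹' S \ D) = if x ∈ S then P (V ⁻¹' S) - P D else P (V ⁻¹' S) := fun {D} hD hDx => by
    split_ifs with hx
    · refine measure_sdiff (fun ω hω => ?_) hD.nullMeasurableSet (measure_ne_top _ _)
      have : V ω = x := hDx hω
      simpa [this] using hx
    · congr 1
      refine sdiff_eq_left.2 (Set.disjoint_left.2 fun ω hω hωD => hx ?_)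
      have : V ω = x := hDx hωD
      exact this ▸ hω
  have hpre : ∀ {D : Set Ω}, MeasurableSet D → D ⊆ V ⁻¹' {x} →
      P ((fun ω => V ω + D.indicator (fun _ => v) ω) ⁻¹' S)
        = (if x + v ∈ S then P D else 0) + P (V ⁻¹' S \ D) := fun {D} hD hDx => by
    have h1 : (fun ω => V ω + D.indicator (fun _ => v) ω) ⁻¹' S \ D = V ⁻¹' S \ D := by
      ext ω
      simp only [Set.mem_sdiff, Set.mem_preimage, and_congr_left_iff]
      intro hω
      simp [hω]
    have h2 : P ((fun ω => V ω + D.indicator (fun _ => v) ω) ⁻¹' S ∩ D)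
        = if x + v ∈ S then P D else 0 := by
      split_ifs with hx
      · congr 1
        refine Set.inter_eq_right.2 fun ω hω => ?_
        have : V ω = x := hDx hω
        simpa [hω, this] using hx
      · rw [← measure_empty (μ := P)]
        congr 1
        refine Set.eq_empty_of_forall_notMem fun ω hω => hx ?_
        have h3 : V ω = x := hDx hω.2
        simpa [hω.2, h3] using hω.1
    rw [← h1, ← h2, measure_inter_add_sdiff _ hD]
  rw [Measure.map_apply (hmeas hA) hS, Measure.map_apply (hmeas hA') hS, hpre hA hAx, hpre hA' hAx',
    hrest hA hAx, hrest hA' hAx', h]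

end LawInvariance

/-! ### The vector measure of an operator -/

section OpMeasure

variable {Ω H U : Type*} [MeasurableSpace Ω] {P : Measure Ω} [IsProbabilityMeasure P]
  [NormedAddCommGroup H] [InnerProductSpace ℝ H]
  [NormedAddCommGroup U] [InnerProductSpace ℝ U]

theorem norm_opMeasure_le (L : Lp H 2 P →L[ℝ] U) {A : Set Ω} (hA : MeasurableSet A) :
    ‖opMeasure P L A‖ ≤ ‖L‖ * √(P.real A) := by
  have h : opMeasure P L A = indicatorOp P L hA := dif_pos hA
  rw [h, Real.sqrt_eq_rpow]
  simpa using norm_indicatorOp_le P L hA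

/-- The vector measure records the values on indicators, whose span is dense in `L²`. -/
theorem opMeasure_injective : Function.Injective (opMeasure P : (Lp H 2 P →L[ℝ] U) → _) :=
  fun L L' h => clm_ext_indicator fun A hA u => by
    rw [← opMeasure_apply, ← opMeasure_apply, h]

variable [CompleteSpace U]

theorem opMeasure_densityOp (G : Lp (H →L[ℝ] U) 2 P) :
    opMeasure P (densityOp P G) = P.withDensityᵥ G := by
  ext A hA u
  rw [opMeasure_apply P _ hA, densityOp_indicator, withDensityᵥ_apply (integrable_Lp_two G) hA,
    ContinuousLinearMap.integral_apply (integrable_Lp_two G).integrableOn]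

end OpMeasure

/-! ### Existence of a density depending only on the law -/

section Density

variable {Ω H U : Type*} [MeasurableSpace Ω] {P : Measure Ω} [IsProbabilityMeasure P]
  [NormedAddCommGroup H] [InnerProductSpace ℝ H] [MeasurableSpace H] [BorelSpace H]
  [NormedAddCommGroup U] [InnerProductSpace ℝ U]
  {ξ : Ω → ℝ} {μ : P2 H}

omit [InnerProductSpace ℝ H] in
theorem measurePreserving_of_law_eq {X : Lp H 2 P} (hX : law P X = μ) :
    MeasurePreserving X P μ.1 :=
  ⟨measurable_coeFn_Lp X, congrArg Subtype.val hX⟩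

/-- Composition with a random variable of law `μ`, as a map `L²(μ) → L²(Ω)`. -/
def compLaw {E : Type*} [NormedAddCommGroup E] {X : Lp H 2 P} (hX : law P X = μ)
    (G : Lp E 2 μ.1) : Lp E 2 P :=
  Lp.compMeasurePreserving X (measurePreserving_of_law_eq hX) G

omit [InnerProductSpace ℝ H] in
theorem isometry_compLaw {E : Type*} [NormedAddCommGroup E] {X : Lp H 2 P} (hX : law P X = μ) :
    Isometry (compLaw hX : Lp E 2 μ.1 → Lp E 2 P) :=
  Lp.isometry_compMeasurePreserving (measurePreserving_of_law_eq hX)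

omit [InnerProductSpace ℝ H] in
theorem compLaw_coeFn {E : Type*} [NormedAddCommGroup E] {X : Lp H 2 P} (hX : law P X = μ)
    (G : Lp E 2 μ.1) : compLaw hX G =ᵐ[P] G ∘ X :=
  Lp.coeFn_compMeasurePreserving G (measurePreserving_of_law_eq hX)

omit [InnerProductSpace ℝ H] in
theorem compLaw_toLp_coeFn {E : Type*} [NormedAddCommGroup E] {χ : H → E} (hχ : MemLp χ 2 μ.1)
    {X : Lp H 2 P} (hX : law P X = μ) : compLaw hX (hχ.toLp χ) =ᵐ[P] χ ∘ X :=
  (hχ.comp_measurePreserving (measurePreserving_of_law_eq hX)).coeFn_toLp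

/-- On a level set of `V`, the measure associated with `Df̂(V)` is proportional to `P`. -/
theorem opMeasure_fderiv_eq_smul [SecondCountableTopology H] (hξ : Measurable ξ)
    (h0 : ∀ t, P (ξ ⁻¹' {t}) = 0) {f : P2 H → U} (hf : Differentiable ℝ (lift P f))
    {Z : Lp H 2 P} {V : Ω → H} (hV : Measurable V) (hZ : Z =ᵐ[P] V) (x : H) {A : Set Ω}
    (hA : MeasurableSet A) (hAx : A ⊆ V ⁻¹' {x}) :
    opMeasure P (fderiv ℝ (lift P f) Z) A
      = (P.real A / P.real (V ⁻¹' {x})) • opMeasure P (fderiv ℝ (lift P f) Z) (V ⁻¹' {x}) := by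
  refine vectorMeasure_eq_smul hξ h0 _ (norm_nonneg (fderiv ℝ (lift P f) Z))
    (fun A hA => norm_opMeasure_le _ hA) (hV (measurableSet_singleton x)) ?_ hA hAx
  intro A A' hA hA' hAx hAx' h
  ext u
  rw [opMeasure_apply P _ hA, opMeasure_apply P _ hA']
  refine fderiv_lift_eq_of_law_eq hf fun t => law_eq_of_ae_eq (add_smul_indicator_coeFn hZ hA u t)
    (add_smul_indicator_coeFn hZ hA' u t) (map_add_indicator_eq hV hA hA' hAx hAx' ?_)
  exact (measureReal_eq_measureReal_iff).1 h

/-- The total mass of a level set of `φ(X)` under the measure associated with `Df̂(φ(X))` depends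
only on the law of `X`. -/
theorem opMeasure_fderiv_comp_eq [SecondCountableTopology H] {f : P2 H → U}
    (hf : Differentiable ℝ (lift P f)) {φ : H → H} (hφ : Measurable φ) {X X' Z Z' : Lp H 2 P}
    (hX : law P X = law P X') (hZ : Z =ᵐ[P] φ ∘ X) (hZ' : Z' =ᵐ[P] φ ∘ X') {S : Set H}
    (hS : MeasurableSet S) :
    opMeasure P (fderiv ℝ (lift P f) Z) (X ⁻¹' S)
      = opMeasure P (fderiv ℝ (lift P f) Z') (X' ⁻¹' S) := by
  have hXm := measurable_coeFn_Lp X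
  have hXm' := measurable_coeFn_Lp X'
  ext u
  rw [opMeasure_apply P _ (hXm hS), opMeasure_apply P _ (hXm' hS)]
  refine fderiv_lift_eq_of_law_eq hf fun t => law_eq_of_ae_eq
    (add_smul_indicator_coeFn hZ (hXm hS) u t) (add_smul_indicator_coeFn hZ' (hXm' hS) u t) ?_
  have hψ : Measurable fun x => φ x + S.indicator (fun _ => t • u) x :=
    hφ.add (measurable_const.indicator hS)
  have hlaw : P.map X = P.map X' := congrArg Subtype.val hX
  have h := congrArg (Measure.map fun x => φ x + S.indicator (fun _ => t • u) x) hlaw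
  rw [Measure.map_map hψ hXm, Measure.map_map hψ hXm'] at h
  exact h

variable [CompleteSpace U]

/-- For a simple function `φ`, the derivative at `φ(X)` has a density of the form `ψ(X)`, where `ψ`
depends on the law of `X` only. -/
theorem exists_density_of_simpleFunc [SecondCountableTopology H] (hξ : Measurable ξ)
    (h0 : ∀ t, P (ξ ⁻¹' {t}) = 0) {f : P2 H → U} (hf : Differentiable ℝ (lift P f))
    (φ : SimpleFunc H H) (hφ : MemLp φ 2 μ.1) :
    ∃ ψ : Lp (H →L[ℝ] U) 2 μ.1, ∀ (X : Lp H 2 P) (hX : law P X = μ),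
      fderiv ℝ (lift P f) (compLaw hX (hφ.toLp φ)) = densityOp P (compLaw hX ψ) := by
  -- A reference variable `X₀` is needed to define `ψ`; without one the claim is vacuous.
  by_cases hex : ∃ X : Lp H 2 P, law P X = μ
  swap
  · exact ⟨0, fun X hX => (hex ⟨X, hX⟩).elim⟩
  obtain ⟨X₀, hX₀⟩ := hex
  have := μ.2.1
  let m₀ := opMeasure P (fderiv ℝ (lift P f) (compLaw hX₀ (hφ.toLp φ)))
  -- The average of the vector measure over a level set of `φ(X₀)`. On null level sets the inverse
  -- is `0`, matching the `0 / 0 = 0` in `opMeasure_fderiv_eq_smul`.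
  let T : H → H →L[ℝ] U := fun x => (P.real (X₀ ⁻¹' (φ ⁻¹' {x})))⁻¹ • m₀ (X₀ ⁻¹' (φ ⁻¹' {x}))
  have hψ : MemLp (φ.map T) 2 μ.1 := SimpleFunc.memLp_of_isFiniteMeasure _ _ _
  refine ⟨hψ.toLp _, fun X hX => opMeasure_injective ?_⟩
  rw [opMeasure_densityOp]
  ext1 A hA
  rw [withDensityᵥ_apply (integrable_Lp_two _) hA]
  have hXm := measurable_coeFn_Lp X
  have hC : ∀ x, MeasurableSet (X ⁻¹' (φ ⁻¹' {x})) := fun x => hXm (φ.measurableSet_fiber x)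
  have hAU : A = ⋃ x ∈ φ.range, A ∩ X ⁻¹' (φ ⁻¹' {x}) := by
    ext ω; simp
  have hdis : (φ.range : Set H).PairwiseDisjoint fun x => A ∩ X ⁻¹' (φ ⁻¹' {x}) :=
    fun x _ y _ hxy => Set.disjoint_left.2 fun ω hω hω' => hxy (by
      have h1 : φ (X ω) = x := hω.2
      have h2 : φ (X ω) = y := hω'.2
      rw [← h1, h2])
  conv_lhs => rw [hAU]
  conv_rhs => rw [hAU]
  rw [VectorMeasure.of_biUnion_finset hdis fun x _ => hA.inter (hC x),
    integral_biUnion_finset _ (fun x _ => hA.inter (hC x)) hdis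
      fun x _ => (integrable_Lp_two _).integrableOn]
  refine Finset.sum_congr rfl fun x _ => ?_
  have hint : ∫ ω in A ∩ X ⁻¹' (φ ⁻¹' {x}), compLaw hX (hψ.toLp _) ω ∂P
      = P.real (A ∩ X ⁻¹' (φ ⁻¹' {x})) • T x := by
    refine (setIntegral_congr_ae (hA.inter (hC x)) ?_).trans (setIntegral_const (T x))
    filter_upwards [compLaw_toLp_coeFn hψ hX] with ω hω hωA
    have h1 : φ (X ω) = x := hωA.2
    rw [hω, Function.comp_apply, SimpleFunc.map_apply, h1]
  rw [hint, opMeasure_fderiv_eq_smul hξ h0 hf (φ.measurable.comp hXm) (compLaw_toLp_coeFn hφ hX) x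
    (hA.inter (hC x)) Set.inter_subset_right, Set.preimage_comp,
    opMeasure_fderiv_comp_eq hf φ.measurable (hX.trans hX₀.symm) (compLaw_toLp_coeFn hφ hX)
      (compLaw_toLp_coeFn hφ hX₀)
      (φ.measurableSet_fiber x)]
  have hPeq : P.real (X ⁻¹' (φ ⁻¹' {x})) = P.real (X₀ ⁻¹' (φ ⁻¹' {x})) := by
    rw [measureReal_def, measureReal_def, (measurePreserving_of_law_eq hX).measure_preimage
      (φ.measurableSet_fiber x).nullMeasurableSet,
      (measurePreserving_of_law_eq hX₀).measure_preimage
        (φ.measurableSet_fiber x).nullMeasurableSet]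
  rw [hPeq, div_eq_mul_inv, mul_smul]

/-- The derivative of a Λ-continuously differentiable lift at `X` has a density of the form `g(X)`,
where `g ∈ L²(μ; L(H, U))` depends on the law `μ` of `X` only. -/
theorem exists_density [SecondCountableTopology H] (hξ : Measurable ξ)
    (h0 : ∀ t, P (ξ ⁻¹' {t}) = 0) {f : P2 H → U} (hf : LambdaContDiff P (lift P f)) (μ : P2 H) :
    ∃ g : Lp (H →L[ℝ] U) 2 μ.1, ∀ (X : Lp H 2 P) (hX : law P X = μ),
      fderiv ℝ (lift P f) X = densityOp P (compLaw hX g) := by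
  by_cases hex : ∃ X : Lp H 2 P, law P X = μ
  swap
  · exact ⟨0, fun X hX => (hex ⟨X, hX⟩).elim⟩
  obtain ⟨X₀, hX₀⟩ := hex
  have hid : MemLp (id : H → H) 2 μ.1 := by
    refine ⟨stronglyMeasurable_id.aestronglyMeasurable, ?_⟩
    rw [eLpNorm_lt_top_iff_lintegral_rpow_enorm_lt_top (by simp) (by simp)]
    simpa using μ.2.2
  let φ : ℕ → SimpleFunc H H := SimpleFunc.approxOn id measurable_id (Set.range id ∪ {0}) 0
    (by simp)
  have hφ : ∀ n, MemLp (φ n) 2 μ.1 := SimpleFunc.memLp_approxOn_range measurable_id hid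
  have hφlim : Tendsto (fun n => (hφ n).toLp (φ n)) atTop (𝓝 (hid.toLp id)) :=
    SimpleFunc.tendsto_approxOn_range_Lp (by simp) measurable_id hid
  choose ψ hψ using fun n => exists_density_of_simpleFunc hξ h0 hf.differentiable (φ n) (hφ n)
  have hcompid : ∀ {X : Lp H 2 P} (hX : law P X = μ), compLaw hX (hid.toLp id) = X := fun {X} hX =>
    Lp.ext (compLaw_toLp_coeFn hid hX)
  -- Composition with `X` is an isometry from `L²(μ)`, so `φ n (X) → X`; continuity in 2-variation
  -- applies at every such `X`, with the same `ψ n`.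
  have htv : ∀ {X : Lp H 2 P} (hX : law P X = μ), Tendsto (fun n => twoVariation P
      (densityOp P (compLaw hX (ψ n)) - fderiv ℝ (lift P f) X)) atTop (𝓝 0) := fun {X} hX => by
    have h1 := ((isometry_compLaw hX).continuous.tendsto _).comp hφlim
    rw [hcompid hX] at h1
    refine ((hf.continuous X).comp h1).congr fun n => ?_
    rw [Function.comp_apply, Function.comp_apply, hψ n X hX]
  -- Distances in `L²(μ)` are 2-variation distances of the operators transported by `X₀`, and these
  -- operators converge.
  have hcauchy : CauchySeq ψ := by
    refine EMetric.cauchySeq_iff.2 fun ε hε => ?_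
    obtain ⟨N, hN⟩ := eventually_atTop.1 ((htv hX₀).eventually
      (gt_mem_nhds (ENNReal.half_pos hε.ne')))
    refine ⟨N, fun n hn k hk => ?_⟩
    have h1 : edist (ψ n) (ψ k)
        = twoVariation P ((densityOp P (compLaw hX₀ (ψ n)) - fderiv ℝ (lift P f) X₀)
          - (densityOp P (compLaw hX₀ (ψ k)) - fderiv ℝ (lift P f) X₀)) := by
      rw [sub_sub_sub_cancel_right, ← densityOp_sub, twoVariation_densityOp, ← Lp.enorm_def,
        ← edist_eq_enorm_sub, (isometry_compLaw hX₀).edist_eq]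
    rw [h1]
    refine (twoVariation_sub_le _ _).trans_lt ?_
    rw [← ENNReal.add_halves ε]
    exact ENNReal.add_lt_add (hN n hn) (hN k hk)
  obtain ⟨g, hg⟩ := cauchySeq_tendsto_of_complete hcauchy
  -- On an indicator, the same sequence converges to the derivative by the 2-variation bound and to
  -- the pairing with `g(X)` by continuity of the pairing.
  refine ⟨g, fun X hX => clm_ext_indicator fun A hA u => ?_⟩
  set Y := indicatorConstLp 2 hA (measure_ne_top P A) u with hY
  have hlim1 : Tendsto (fun n => densityOp P (compLaw hX (ψ n)) Y) atTop
      (𝓝 (fderiv ℝ (lift P f) X Y)) := by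
    rw [tendsto_iff_edist_tendsto_0]
    have h2 := ENNReal.Tendsto.const_mul (a := ‖u‖ₑ) (htv hX) (Or.inr (by simp))
    rw [mul_zero] at h2
    refine tendsto_of_tendsto_of_tendsto_of_le_of_le tendsto_const_nhds h2 (fun _ => zero_le)
      fun n => ?_
    rw [edist_eq_enorm_sub]
    exact enorm_indicator_le_twoVariation
      (densityOp P (compLaw hX (ψ n)) - fderiv ℝ (lift P f) X) hA u
  have hlim2 : Tendsto (fun n => densityOp P (compLaw hX (ψ n)) Y) atTop
      (𝓝 (densityOp P (compLaw hX g) Y)) := by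
    have h1 := ((isometry_compLaw hX).continuous.tendsto _).comp hg
    have h2 : Continuous fun G : Lp (H →L[ℝ] U) 2 P => densityOp P G Y :=
      ((ContinuousLinearMap.id ℝ (H →L[ℝ] U)).lpPairing P 2 2).continuous.clm_apply continuous_const
    exact (h2.tendsto _).comp h1
  exact tendsto_nhds_unique hlim1 hlim2

end Density

/-! ### Integration against the vector measure -/

section Integral

/-- Integration of square integrable functions against a vector measure is a continuous operator
if it satisfies an `L²`-bound. -/
theorem exists_clm_integral {Ω E F V : Type*} [MeasurableSpace Ω] {P : Measure Ω}
    [NormedAddCommGroup E] [NormedSpace ℝ E] [NormedAddCommGroup F] [NormedSpace ℝ F]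
    [NormedAddCommGroup V] [NormedSpace ℝ V] (m : VectorMeasure Ω F) (B : E →L[ℝ] F →L[ℝ] V)
    {C : ℝ} (hC : 0 ≤ C) (hac : m.variation ≪ P)
    (hm : ∀ Y : Lp E 2 P, ∫⁻ ω, ‖Y ω‖ₑ ∂m.variation ≤ ENNReal.ofReal C * ‖Y‖ₑ) :
    ∃ T : Lp E 2 P →L[ℝ] V, ∀ Y, T Y = m.integral Y B := by
  have hint : ∀ Y : Lp E 2 P, m.Integrable Y := fun Y =>
    ⟨(Lp.aestronglyMeasurable Y).mono_ac hac, (hm Y).trans_lt (by finiteness)⟩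
  refine ⟨LinearMap.mkContinuous
    { toFun := fun Y => m.integral Y B
      map_add' := fun Y Z => ?_
      map_smul' := fun c Y => ?_ } (‖B‖ * C) fun Y => ?_, fun Y => rfl⟩
  · rw [VectorMeasure.integral_congr_ae (hac (Lp.coeFn_add Y Z))]
    exact VectorMeasure.integral_add (hint Y) (hint Z)
  · rw [VectorMeasure.integral_congr_ae (hac (Lp.coeFn_smul c Y))]
    exact VectorMeasure.integral_smul _ m B c
  · refine VectorMeasure.norm_integral_le_lintegral_norm.trans ?_
    rw [mul_assoc]
    gcongr
    refine ENNReal.toReal_le_of_le_ofReal (by positivity) ?_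
    simp_rw [ofReal_norm]
    refine (hm Y).trans_eq ?_
    rw [ENNReal.ofReal_mul hC, ofReal_norm]

variable {Ω H U : Type*} [MeasurableSpace Ω] {P : Measure Ω} [IsProbabilityMeasure P]
  [NormedAddCommGroup H] [InnerProductSpace ℝ H]
  [NormedAddCommGroup U] [InnerProductSpace ℝ U] [CompleteSpace U]

theorem variation_opMeasure_densityOp (G : Lp (H →L[ℝ] U) 2 P) :
    VectorMeasure.variation (V := H →L[ℝ] U) (opMeasure P (densityOp P G))
      = P.withDensity fun ω => ‖G ω‖ₑ := by
  rw [opMeasure_densityOp, Measure.variation_withDensityᵥ (integrable_Lp_two G)]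

theorem variation_opMeasure_absolutelyContinuous (G : Lp (H →L[ℝ] U) 2 P) :
    VectorMeasure.variation (V := H →L[ℝ] U) (opMeasure P (densityOp P G)) ≪ P := by
  rw [variation_opMeasure_densityOp]
  exact withDensity_absolutelyContinuous _ _

/-- The variation has density `‖G‖` with respect to `P`, so this is Cauchy–Schwarz. It yields both
integrability of `Y` and continuity of the vector integral on `L²`. -/
theorem lintegral_enorm_variation_le (G : Lp (H →L[ℝ] U) 2 P) {Y : Ω → H} (hY : MemLp Y 2 P) :
    ∫⁻ ω, ‖Y ω‖ₑ ∂(VectorMeasure.variation (V := H →L[ℝ] U) (opMeasure P (densityOp P G)))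
      ≤ eLpNorm G 2 P * eLpNorm Y 2 P := by
  have hG := (Lp.stronglyMeasurable G).enorm
  rw [variation_opMeasure_densityOp, lintegral_withDensity_eq_lintegral_mul₀' hG.aemeasurable
    (hY.1.enorm.mono_ac (withDensity_absolutelyContinuous _ _)), eLpNorm_two_eq, eLpNorm_two_eq]
  simpa using ENNReal.lintegral_mul_le_Lp_mul_Lq P Real.HolderConjugate.two_two hG.aemeasurable
    hY.1.enorm

theorem integrable_opMeasure_densityOp (G : Lp (H →L[ℝ] U) 2 P) {Y : Ω → H} (hY : MemLp Y 2 P) :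
    (opMeasure P (densityOp P G)).Integrable Y :=
  ⟨hY.1.mono_ac (variation_opMeasure_absolutelyContinuous G),
    (lintegral_enorm_variation_le G hY).trans_lt (ENNReal.mul_lt_top (Lp.eLpNorm_lt_top G) hY.2)⟩

theorem integral_opMeasure_congr (G : Lp (H →L[ℝ] U) 2 P) {Y Y' : Ω → H} (h : Y =ᵐ[P] Y') :
    (opMeasure P (densityOp P G)).integral Y (ContinuousLinearMap.apply ℝ U)
      = (opMeasure P (densityOp P G)).integral Y' (ContinuousLinearMap.apply ℝ U) :=
  VectorMeasure.integral_congr_ae ((variation_opMeasure_absolutelyContinuous G) h)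

/-- Both sides are continuous linear operators of `Y` in `L²`, and they agree on indicators by the
definition of the vector measure. -/
theorem integral_opMeasure_eq (G : Lp (H →L[ℝ] U) 2 P) {Y : Ω → H} (hY : MemLp Y 2 P) :
    (opMeasure P (densityOp P G)).integral Y (ContinuousLinearMap.apply ℝ U)
      = ∫ ω, G ω (Y ω) ∂P := by
  obtain ⟨T, hT⟩ := exists_clm_integral (opMeasure P (densityOp P G))
    (ContinuousLinearMap.apply ℝ U) (norm_nonneg G) (variation_opMeasure_absolutelyContinuous G)
    fun Y => (lintegral_enorm_variation_le G (Lp.memLp Y)).trans_eq (by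
      rw [ofReal_norm, Lp.enorm_def, Lp.enorm_def])
  have hTG : T = densityOp P G := clm_ext_indicator fun A hA u => by
    have hfin : IsFiniteMeasure
        (VectorMeasure.variation (V := H →L[ℝ] U) (opMeasure P (densityOp P G))) := by
      rw [variation_opMeasure_densityOp]
      exact isFiniteMeasure_withDensity (integrable_Lp_two G).2.ne
    rw [hT, integral_opMeasure_congr G indicatorConstLp_coeFn,
      VectorMeasure.integral_indicator_const _ hA, ContinuousLinearMap.apply_apply,
      opMeasure_apply P _ hA]
  rw [← integral_opMeasure_congr G hY.coeFn_toLp, ← hT, hTG, densityOp_apply]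
  refine integral_congr_ae ?_
  filter_upwards [hY.coeFn_toLp] with ω hω
  rw [hω]

omit [IsProbabilityMeasure P] [CompleteSpace U] in
theorem integrable_apply_of_memLp {G : Ω → H →L[ℝ] U} {Y : Ω → H} (hG : MemLp G 2 P)
    (hY : MemLp Y 2 P) : Integrable (fun ω => G ω (Y ω)) P :=
  memLp_one_iff_integrable.1 ((ContinuousLinearMap.id ℝ (H →L[ℝ] U)).memLp_of_bilin 1 hG hY)

/-- If `G` is `m`-measurable, then `𝔼[G Y] = 𝔼[G 𝔼[Y|m]]`. -/
theorem integral_apply_condExp {Ω H U : Type*} [NormedAddCommGroup H] [InnerProductSpace ℝ H]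
    [CompleteSpace H] [NormedAddCommGroup U] [InnerProductSpace ℝ U] [CompleteSpace U]
    {m m₀ : MeasurableSpace Ω} {P : Measure Ω} [IsProbabilityMeasure P] (hm : m ≤ m₀)
    {G : Ω → H →L[ℝ] U} {Y : Ω → H} (hGm : StronglyMeasurable[m] G) (hG : MemLp G 2 P)
    (hY : MemLp Y 2 P) : ∫ ω, G ω (P[Y|m] ω) ∂P = ∫ ω, G ω (Y ω) ∂P := by
  -- Tower property; the measurable factor `G` is then pulled out of the conditional expectation.
  rw [← integral_condExp hm (f := fun ω => G ω (Y ω))]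
  refine (integral_congr_ae ?_).symm
  exact condExp_bilin_of_stronglyMeasurable_left (ContinuousLinearMap.id ℝ (H →L[ℝ] U)) hGm
    (integrable_apply_of_memLp hG hY) (hY.integrable (by norm_num))

end Integral

/-! ### Image under `X` and uniqueness of the density -/

section Derivative

variable {Ω H U : Type*} [MeasurableSpace Ω] {P : Measure Ω} [IsProbabilityMeasure P]
  [NormedAddCommGroup H] [InnerProductSpace ℝ H] [MeasurableSpace H] [BorelSpace H]
  [NormedAddCommGroup U] [InnerProductSpace ℝ U] [CompleteSpace U] {μ : P2 H}

theorem densityOp_compLaw_apply {X : Lp H 2 P} (hX : law P X = μ) (g : Lp (H →L[ℝ] U) 2 μ.1)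
    (Y : Lp H 2 P) : densityOp P (compLaw hX g) Y = ∫ ω, g (X ω) (Y ω) ∂P := by
  rw [densityOp_apply]
  refine integral_congr_ae ?_
  filter_upwards [compLaw_coeFn hX g] with ω hω
  rw [hω, Function.comp_apply]

/-- The image under `X` of the measure of an operator with density `g(X)` has density `g` with
respect to the law of `X`. -/
theorem map_opMeasure_densityOp {X : Lp H 2 P} (hX : law P X = μ) (g : Lp (H →L[ℝ] U) 2 μ.1) :
    (opMeasure P (densityOp P (compLaw hX g))).map X = μ.1.withDensityᵥ g := by
  have := μ.2.1
  have hXm := measurable_coeFn_Lp X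
  ext1 A hA
  rw [VectorMeasure.map_apply _ hXm hA, opMeasure_densityOp,
    withDensityᵥ_apply (integrable_Lp_two _) (hXm hA), withDensityᵥ_apply (integrable_Lp_two _) hA]
  have hmap : μ.1 = P.map X := (measurePreserving_of_law_eq hX).map_eq.symm
  have h1 : ∫ x in A, g x ∂(P.map X) = ∫ ω in X ⁻¹' A, g (X ω) ∂P :=
    setIntegral_map hA (Lp.stronglyMeasurable g).aestronglyMeasurable hXm.aemeasurable
  rw [← hmap] at h1
  rw [h1]
  refine setIntegral_congr_ae (hXm hA) ?_
  filter_upwards [compLaw_coeFn hX g] with ω hω _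
  rw [hω, Function.comp_apply]

/-- The image measure under `X` recovers the density `g` from the operator. -/
theorem densityOp_compLaw_injective {X : Lp H 2 P} (hX : law P X = μ)
    {g g' : Lp (H →L[ℝ] U) 2 μ.1}
    (h : densityOp P (compLaw hX g) = densityOp P (compLaw hX g')) : g = g' := by
  have := μ.2.1
  refine Lp.ext ((integrable_Lp_two g).ae_eq_of_withDensityᵥ_eq (integrable_Lp_two g') ?_)
  rw [← map_opMeasure_densityOp hX, ← map_opMeasure_densityOp hX, h]

end Derivative

end LionsDeriv

end

/-! ### The main theorem -/

open LionsDeriv in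
theorem theorem1p2 {Ω H U : Type*}
    [TopologicalSpace Ω] [PolishSpace Ω] [MeasurableSpace Ω] [OpensMeasurableSpace Ω]
    (P : Measure Ω) [IsProbabilityMeasure P] (hP : Atomless P)
    [NormedAddCommGroup H] [InnerProductSpace ℝ H] [CompleteSpace H]
    [TopologicalSpace.SeparableSpace H] [MeasurableSpace H] [BorelSpace H]
    [NormedAddCommGroup U] [InnerProductSpace ℝ U] [CompleteSpace U]
    [TopologicalSpace.SeparableSpace U]
    (f : P2 H → U) (hf : LambdaContDiff P (lift P f)) (μ : P2 H) :
    ∃ g : H → H →L[ℝ] U, StronglyMeasurable g ∧ ∃ hg : MemLp g 2 μ.1,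
      (∀ X : Lp H 2 P, law P X = μ →
        MemLp (fun ω => g (X ω)) 2 P ∧
        (∀ Y : Lp H 2 P,
          Integrable (fun ω => g (X ω) (Y ω)) P ∧
          (opMeasure P (fderiv ℝ (lift P f) X)).Integrable Y ∧
          (opMeasure P (fderiv ℝ (lift P f) X)).Integrable
            (condExp (MeasurableSpace.comap X inferInstance) P Y) ∧
          fderiv ℝ (lift P f) X Y =
            (opMeasure P (fderiv ℝ (lift P f) X)).integral Y (ContinuousLinearMap.apply ℝ U) ∧
          fderiv ℝ (lift P f) X Y =
            (opMeasure P (fderiv ℝ (lift P f) X)).integral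
              (condExp (MeasurableSpace.comap X inferInstance) P Y)
              (ContinuousLinearMap.apply ℝ U) ∧
          fderiv ℝ (lift P f) X Y = ∫ ω, g (X ω) (Y ω) ∂P) ∧
        (∫⁻ ω, ‖g (X ω)‖ₑ ^ 2 ∂P) ^ (1 / 2 : ℝ) = twoVariation P (fderiv ℝ (lift P f) X) ∧
        (opMeasure P (fderiv ℝ (lift P f) X)).map X = μ.1.withDensityᵥ g ∧
        (∀ A : Set H, MeasurableSet A → ∀ u : H,
          (opMeasure P (fderiv ℝ (lift P f) X)).map X A u = ∫ x in A, g x u ∂μ.1) ∧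
        (∀ G : Lp (H →L[ℝ] U) 2 μ.1,
          (opMeasure P (fderiv ℝ (lift P f) X)).map X = μ.1.withDensityᵥ G → G = hg.toLp g)) ∧
      (∀ G : Lp (H →L[ℝ] U) 2 μ.1, IsLDerivative P f μ G ↔ G = hg.toLp g) := by
  have := UniformSpace.secondCountable_of_separable H
  have := μ.2.1
  obtain ⟨ξ, hξ, h0⟩ := exists_measurable_preimage_singleton_null hP
  obtain ⟨g, hg⟩ := exists_density hξ h0 hf μ
  refine ⟨g, Lp.stronglyMeasurable g, Lp.memLp g, fun X hX => ?_, fun G => ?_⟩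
  · have hgX : MemLp (fun ω => g (X ω)) 2 P :=
      (Lp.memLp g).comp_measurePreserving (measurePreserving_of_law_eq hX)
    have hm : MeasurableSpace.comap X inferInstance ≤ ‹MeasurableSpace Ω› :=
      (measurable_coeFn_Lp X).comap_le
    -- Conditioning needs the representative `g ∘ X` itself: the one chosen for the class `compLaw
    -- hX g` is only almost everywhere a function of `X`.
    have hgXm : StronglyMeasurable[MeasurableSpace.comap X inferInstance] fun ω => g (X ω) :=
      (Lp.stronglyMeasurable g).comp_measurable (comap_measurable X)
    rw [hg X hX]
    refine ⟨hgX, fun Y => ?_, ?_, map_opMeasure_densityOp hX g, fun A hA u => ?_, fun G hG => ?_⟩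
    · have hY := Lp.memLp Y
      have hYX : MemLp (condExp (MeasurableSpace.comap X inferInstance) P Y) 2 P :=
        hY.condExp (by norm_num)
      refine ⟨integrable_apply_of_memLp hgX hY, integrable_opMeasure_densityOp _ hY,
        integrable_opMeasure_densityOp _ hYX, ?_, ?_, densityOp_compLaw_apply hX g Y⟩
      · rw [integral_opMeasure_eq _ hY, densityOp_apply]
      · rw [integral_opMeasure_eq _ hYX, densityOp_compLaw_apply,
          ← integral_apply_condExp hm hgXm hgX hY]
        refine integral_congr_ae ?_
        filter_upwards [compLaw_coeFn hX g] with ω hω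
        rw [hω, Function.comp_apply]
    · rw [twoVariation_densityOp, eLpNorm_congr_ae (compLaw_coeFn hX g), eLpNorm_two_eq]
      rfl
    · rw [map_opMeasure_densityOp hX, withDensityᵥ_apply (integrable_Lp_two g) hA,
        ContinuousLinearMap.integral_apply (integrable_Lp_two g).integrableOn]
    · rw [map_opMeasure_densityOp hX] at hG
      rw [Lp.toLp_coeFn]
      exact (Lp.ext ((integrable_Lp_two g).ae_eq_of_withDensityᵥ_eq (integrable_Lp_two G) hG)).symm
  · rw [Lp.toLp_coeFn]
    constructor
    · intro hG
      -- Without some `X` of law `μ`, every class `G` would satisfy the defining identity vacuously.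
      obtain ⟨X, hX⟩ := exists_law_eq hξ h0 μ
      refine densityOp_compLaw_injective hX (ContinuousLinearMap.ext fun Y => ?_)
      rw [densityOp_compLaw_apply, ← hG X hX Y, hg X hX]
    · rintro rfl X hX Y
      rw [hg X hX, densityOp_compLaw_apply]
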